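/- For nonzero $x,z\in\mathbb{R}^n$ let $W_{x,z}=\{v\in S^{n-1} : \operatorname{sign}\langle v,x\rangle\neq\operatorname{sign}\langle v,z\rangle\}$ (with $\operatorname{sign}$ taking values in $\{-1,0,1\}$) be the spherical wedge with normal vectors $x$ and $z$; its angle is the angle between $x$ and $z$. Fix $0<\theta<\pi/2$ and let $\mathcal{W}_\theta$ be the collection of all wedges of $S^{n-1}$ of angle less than $\theta$. Let $n\ge 1$, $\delta>0$, and let $m$ be an integer with $2m\ge n$. Let $a_1,\dots,a_m$ be independent random vectors, each uniformly distributed on $S^{n-1}$, and let $\mu_A=\frac1m\sum_{i=1}^m\delta_{a_i}$ be their empirical measure. If $$m\;\ge\;\Big(\frac{4\pi}{\theta}\Big)^2\Big(2n\log\frac{2em}{n}+\log\frac{2}{\delta}\Big),$$ then with probability at least $1-\delta$, $$\sup_{W\in\mathcal{W}_\theta}\mu_A(W)\;\le\;\frac{2\theta}{\pi}.$$ -/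

import Mathlib

open MeasureTheory ProbabilityTheory
open scoped ENNReal

noncomputable section

namespace SphericalWedge

/-- The unit sphere `S^{n-1}` of the Euclidean space `ℝⁿ`. -/
abbrev UnitSphere (n : ℕ) : Type :=
  Metric.sphere (0 : EuclideanSpace ℝ (Fin n)) 1

/-- The uniform probability measure on `S^{n-1}`: the surface measure induced by Lebesgue measure,
normalized to total mass one. -/
def uniform (n : ℕ) : Measure (UnitSphere n) :=
  ((volume : Measure (EuclideanSpace ℝ (Fin n))).toSphere Set.univ)⁻¹ •
    (volume : Measure (EuclideanSpace ℝ (Fin n))).toSphere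

/-- The region `W_{x,z}` of the sphere lying between the hemispheres with normal vectors `x` and
`z`; here `SignType.sign` is the sign with values in `{-1, 0, 1}`. -/
def wedge {n : ℕ} (x z : EuclideanSpace ℝ (Fin n)) : Set (UnitSphere n) :=
  {v | SignType.sign (inner ℝ (v : EuclideanSpace ℝ (Fin n)) x) ≠
    SignType.sign (inner ℝ (v : EuclideanSpace ℝ (Fin n)) z)}

/-- The collection of all wedges of `S^{n-1}` of angle less than `θ`, the angle of a wedge being
the angle between the two normal vectors. -/
def wedgesBelow (n : ℕ) (θ : ℝ) : Set (Set (UnitSphere n)) :=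
  {W | ∃ x z : EuclideanSpace ℝ (Fin n), x ≠ 0 ∧ z ≠ 0 ∧
    InnerProductGeometry.angle x z < θ ∧ W = wedge x z}

/-- The empirical measure `(1/m) ∑ δ_{a_i}` of `m` points on the sphere. -/
def empirical {n m : ℕ} (a : Fin m → UnitSphere n) : Measure (UnitSphere n) :=
  (m : ℝ≥0∞)⁻¹ • ∑ i, Measure.dirac (a i)

end SphericalWedge

end

/-! Put `ε = θ / π`. A wedge of angle below `θ` has uniform measure at most `ε`, so it suffices that
no wedge receives more than twice `ε * m` sample points. This is a one-sided Vapnik–Chervonenkis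
bound.

Up to null equators a wedge is a symmetric difference of two hemispheres. Half-spaces through the
origin have VC dimension at most `n`, so by Sauer–Shelah these differences leave at most
`(2em/n)^(2n)` traces on `2m` points. Comparison with an independent ghost sample
(`measure_exists_hits_gt_le`), random swaps between the two samples and Hoeffding's inequality
(`measure_exists_hitsDiff_gt_le`) bound the failure probability by `3 (2em/n)^(2n) exp(-mε²/8)`,
which the hypothesis on `m` makes at most `δ`.

There are uncountably many wedges, and they include points where just one form vanishes. On a finite
sample each wedge is dominated by an open wedge with normals in a countable dense set
(`exists_mem_dense_wedge_inter_subset`), so a countable family suffices. -/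

namespace SphericalWedge

/-! ### Binomial sums and Hoeffding's inequality for signs -/

theorem sum_choose_le_rpow {N n : ℕ} (hn : 1 ≤ n) (hN : n ≤ N) :
    ((∑ k ∈ Finset.Iic n, N.choose k : ℕ) : ℝ) ≤ (Real.exp 1 * N / n) ^ n := by
  have hn0 : (0 : ℝ) < n := by exact_mod_cast hn
  have hN0 : (0 : ℝ) < N := lt_of_lt_of_le hn0 (by exact_mod_cast hN)
  have hq : (n : ℝ) / N ≤ 1 := (div_le_one hN0).2 (by exact_mod_cast hN)
  have hq0 : 0 < (n : ℝ) / N := by positivity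
  -- Since `n / N ≤ 1`, the weight `(n/N)^n` is at most `(n/N)^k` for `k ≤ n`; the weighted sum is
  -- then part of the binomial expansion of `(1 + n/N)^N ≤ e^n`.
  have h1 : ((∑ k ∈ Finset.Iic n, N.choose k : ℕ) : ℝ) * ((n : ℝ) / N) ^ n
      ≤ Real.exp n := by
    calc ((∑ k ∈ Finset.Iic n, N.choose k : ℕ) : ℝ) * ((n : ℝ) / N) ^ n
        = ∑ k ∈ Finset.Iic n, (N.choose k : ℝ) * ((n : ℝ) / N) ^ n := by
          push_cast; rw [Finset.sum_mul]
      _ ≤ ∑ k ∈ Finset.Iic n, (N.choose k : ℝ) * ((n : ℝ) / N) ^ k := by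
          refine Finset.sum_le_sum fun k hk => ?_
          exact mul_le_mul_of_nonneg_left
            (pow_le_pow_of_le_one hq0.le hq (Finset.mem_Iic.1 hk)) (by positivity)
      _ ≤ ∑ k ∈ Finset.range (N + 1), (N.choose k : ℝ) * ((n : ℝ) / N) ^ k := by
          refine Finset.sum_le_sum_of_subset_of_nonneg ?_ fun _ _ _ => by positivity
          intro k hk
          have := Finset.mem_Iic.1 hk
          exact Finset.mem_range.2 (by omega)
      _ = ((n : ℝ) / N + 1) ^ N := by
          rw [add_pow]
          exact Finset.sum_congr rfl fun k _ => by rw [one_pow]; ring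
      _ ≤ (Real.exp ((n : ℝ) / N)) ^ N := by
          gcongr
          exact Real.add_one_le_exp _
      _ = Real.exp n := by
          rw [← Real.exp_nat_mul]; congr 1; field_simp
  have h2 : (Real.exp 1 * N / n) ^ n = Real.exp n / ((n : ℝ) / N) ^ n := by
    rw [← Real.exp_one_pow n, ← div_pow]
    congr 1; field_simp
  rw [h2, le_div_iff₀ (by positivity)]
  exact h1

/-- A finite Hoeffding inequality for weighted sums of signs, stated as a count. -/
theorem card_signs_le {m : ℕ} (hm : 0 < m) (c : Fin m → ℝ) (hc : ∀ i, |c i| ≤ 1) {t : ℝ}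
    (ht : 0 ≤ t) :
    ((Finset.univ.filter fun s : Fin m → Bool =>
      t < ∑ i, (if s i then c i else - c i)).card : ℝ) ≤ 2 ^ m * Real.exp (-(t ^ 2 / (2 * m))) := by
  have hm0 : (0 : ℝ) < m := by exact_mod_cast hm
  -- The Chernoff parameter minimizing `m l² / 2 - l t`.
  set l : ℝ := t / m with hl
  have hl0 : 0 ≤ l := by positivity
  have hsum : ∑ s : Fin m → Bool, Real.exp (l * ∑ i, (if s i then c i else - c i))
      ≤ 2 ^ m * Real.exp (m * (l ^ 2 / 2)) := by
    calc ∑ s : Fin m → Bool, Real.exp (l * ∑ i, (if s i then c i else - c i))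
        = ∑ s : Fin m → Bool, ∏ i, Real.exp (l * (if s i then c i else - c i)) := by
          simp_rw [Finset.mul_sum, Real.exp_sum]
      _ = ∏ i, ∑ b : Bool, Real.exp (l * (if b then c i else - c i)) :=
          (Fintype.prod_sum fun i (b : Bool) => Real.exp (l * (if b then c i else - c i))).symm
      _ ≤ ∏ _i : Fin m, (2 * Real.exp (l ^ 2 / 2)) := by
          refine Finset.prod_le_prod (fun i _ => by positivity) fun i _ => ?_
          have h1 := Real.cosh_le_exp_half_sq (l * c i)
          rw [Real.cosh_eq] at h1
          have h2 : Real.exp ((l * c i) ^ 2 / 2) ≤ Real.exp (l ^ 2 / 2) := by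
            apply Real.exp_le_exp.2
            have : c i ^ 2 ≤ 1 := (sq_le_one_iff_abs_le_one _).2 (hc i)
            rw [mul_pow]
            nlinarith [sq_nonneg l]
          simp only [Fintype.sum_bool, if_true, Bool.false_eq_true, if_false, mul_neg]
          linarith
      _ = 2 ^ m * Real.exp (m * (l ^ 2 / 2)) := by
          rw [Finset.prod_const, Finset.card_univ, Fintype.card_fin, mul_pow, ← Real.exp_nat_mul]
  have hle : ((Finset.univ.filter fun s : Fin m → Bool =>
      t < ∑ i, (if s i then c i else - c i)).card : ℝ) * Real.exp (l * t)
      ≤ ∑ s : Fin m → Bool, Real.exp (l * ∑ i, (if s i then c i else - c i)) := by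
    rw [← nsmul_eq_mul]
    refine (Finset.card_nsmul_le_sum _ _ _ fun s hs => ?_).trans
      (Finset.sum_le_sum_of_subset_of_nonneg (Finset.filter_subset _ _)
        fun _ _ _ => (Real.exp_pos _).le)
    exact Real.exp_le_exp.2 (mul_le_mul_of_nonneg_left (Finset.mem_filter.1 hs).2.le hl0)
  have h3 : 2 ^ m * Real.exp (-(t ^ 2 / (2 * m))) =
      2 ^ m * Real.exp (m * (l ^ 2 / 2)) / Real.exp (l * t) := by
    rw [mul_div_assoc, ← Real.exp_sub]
    congr 2
    rw [hl]; field_simp; ring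
  rw [h3, le_div_iff₀ (Real.exp_pos _)]
  exact hle.trans hsum

/-! ### VC dimension of half-spaces through the origin -/

section HalfSpaces

variable {E : Type*} [NormedAddCommGroup E] [InnerProductSpace ℝ E]

open Classical in
/-- The subsets cut out of a finite family of points by open half-spaces through the origin. -/
noncomputable def halfSpaceTraces {ι : Type*} [Fintype ι] (c : ι → E) : Finset (Finset ι) :=
  Finset.univ.filter fun s => ∃ x : E, s = Finset.univ.filter fun i => 0 < inner ℝ (c i) x

open Classical in
-- More points than the dimension satisfy a relation `∑ g i • c i = 0`. If a half-space cut out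
-- exactly the points with `g i > 0`, pairing the relation with its normal would give nonnegative
-- terms, one of them positive, with sum zero.
theorem vcDim_halfSpaceTraces_le [FiniteDimensional ℝ E] {ι : Type*} [Fintype ι] (c : ι → E) :
    (halfSpaceTraces c).vcDim ≤ Module.finrank ℝ E := by
  refine Finset.sup_le fun s hs => ?_
  rw [Finset.mem_shatterer] at hs
  by_contra! hcard
  obtain ⟨g, hg0, i₀, hi₀, hgi₀⟩ : ∃ g : ι → ℝ, ∑ i ∈ s, g i • c i = 0 ∧ ∃ i ∈ s, 0 < g i := by
    have hnot : ¬ LinearIndependent ℝ (fun i : s => c i) := fun h => by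
      have := h.fintype_card_le_finrank
      rw [Fintype.card_coe] at this
      omega
    obtain ⟨g, hg, i, hi⟩ := Fintype.not_linearIndependent_iff.1 hnot
    let G : ι → ℝ := fun j => if h : j ∈ s then g ⟨j, h⟩ else 0
    have hG : ∑ j ∈ s, G j • c j = 0 := by
      rw [← hg, ← Finset.sum_coe_sort]
      exact Finset.sum_congr rfl fun j _ => by simp [G]
    have hGi : G i = g i := by simp [G]
    -- Changing the sign of the relation if necessary makes some coefficient positive.
    rcases lt_or_gt_of_ne hi with h | h
    · refine ⟨fun j => -G j, by simp [hG], i, i.2, ?_⟩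
      simpa [hGi] using h
    · exact ⟨G, hG, i, i.2, by simpa [hGi] using h⟩
  obtain ⟨u, hu, hsu⟩ := hs (Finset.filter_subset (fun i => 0 < g i) s)
  obtain ⟨x, rfl⟩ := (Finset.mem_filter.1 hu).2
  have hiff : ∀ i ∈ s, (0 < inner ℝ (c i) x ↔ 0 < g i) := fun i hi => by
    have := Finset.ext_iff.1 hsu i
    simpa [hi] using this
  have hzero : ∑ i ∈ s, g i * inner ℝ (c i) x = 0 := by
    have : inner ℝ (∑ i ∈ s, g i • c i) x = 0 := by rw [hg0, inner_zero_left]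
    simpa [sum_inner, real_inner_smul_left] using this
  have hpos : 0 < ∑ i ∈ s, g i * inner ℝ (c i) x := by
    refine Finset.sum_pos' (fun i hi => ?_) ⟨i₀, hi₀, mul_pos hgi₀ ((hiff i₀ hi₀).2 hgi₀)⟩
    by_cases h : 0 < g i
    · exact (mul_pos h ((hiff i hi).2 h)).le
    · exact mul_nonneg_of_nonpos_of_nonpos (not_lt.1 h)
        (not_lt.1 fun h' => h ((hiff i hi).1 h'))
  exact hpos.ne' hzero

theorem card_halfSpaceTraces_le [FiniteDimensional ℝ E] {ι : Type*} [Fintype ι] (c : ι → E) :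
    (halfSpaceTraces c).card ≤
      ∑ k ∈ Finset.Iic (Module.finrank ℝ E), (Fintype.card ι).choose k := by
  classical
  refine (Finset.card_le_card_shatterer _).trans (Finset.card_shatterer_le_sum_vcDim.trans ?_)
  refine Finset.sum_le_sum_of_subset (Finset.Iic_subset_Iic.2 ?_)
  convert vcDim_halfSpaceTraces_le c

end HalfSpaces

/-! ### Measure of wedges and reduction to a dense set of normals -/

section Geometry

/-- The floor `k` numbers the half period containing the point, and there `(-1)^k cos ≥ 0`; strictly
opposite signs therefore need different floors. -/
theorem floor_lt_floor_of_cos_mul_cos_neg {s t : ℝ} (hst : s ≤ t)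
    (h : Real.cos s * Real.cos t < 0) :
    ⌊s / Real.pi + 1 / 2⌋ + 1 ≤ ⌊t / Real.pi + 1 / 2⌋ := by
  have hpi := Real.pi_pos
  have hsign : ∀ (u : ℝ) (k : ℤ), ⌊u / Real.pi + 1 / 2⌋ = k → 0 ≤ (-1) ^ k * Real.cos u := by
    intro u k hk
    rw [Int.floor_eq_iff] at hk
    rw [← Real.cos_sub_int_mul_pi]
    have e : u / Real.pi * Real.pi = u := by field_simp
    apply Real.cos_nonneg_of_neg_pi_div_two_le_of_le <;> nlinarith [hk.1, hk.2]
  have hmono : ⌊s / Real.pi + 1 / 2⌋ ≤ ⌊t / Real.pi + 1 / 2⌋ := Int.floor_mono (by gcongr)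
  refine Int.add_one_le_iff.2 (lt_of_le_of_ne hmono fun heq => ?_)
  have h1 := mul_nonneg (hsign s _ heq) (hsign t _ rfl)
  have h2 : ((-1 : ℝ) ^ ⌊t / Real.pi + 1 / 2⌋) * (-1) ^ ⌊t / Real.pi + 1 / 2⌋ = 1 := by
    rw [← mul_zpow]; simp
  have h3 : (-1 : ℝ) ^ ⌊t / Real.pi + 1 / 2⌋ * Real.cos s *
      ((-1) ^ ⌊t / Real.pi + 1 / 2⌋ * Real.cos t) = Real.cos s * Real.cos t := by
    linear_combination (Real.cos s * Real.cos t) * h2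
  linarith

open Classical in
/-- Along an arithmetic progression of step `α`, the function `t ↦ r cos (t - φ)` changes sign at
most once per half period. -/
theorem sum_sign_changes_le {r φ α : ℝ} (hα : 0 ≤ α) (N : ℕ) :
    ∑ j ∈ Finset.range N, (if (r * Real.cos (j * α - φ)) * (r * Real.cos ((j + 1 : ℕ) * α - φ)) < 0
      then (1 : ℝ) else 0) ≤ N * α / Real.pi + 1 := by
  -- Each sign change is paid for by an increment of `g`; the sum telescopes and rounding costs at
  -- most 1.
  let g : ℕ → ℤ := fun j => ⌊((j : ℝ) * α - φ) / Real.pi + 1 / 2⌋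
  have hstep : ∀ j : ℕ,
      (if (r * Real.cos (j * α - φ)) * (r * Real.cos ((j + 1 : ℕ) * α - φ)) < 0
        then (1 : ℝ) else 0) ≤ (g (j + 1) : ℝ) - g j := by
    intro j
    have hle : (j : ℝ) * α - φ ≤ ((j + 1 : ℕ) : ℝ) * α - φ := by push_cast; linarith
    split_ifs with h
    · have h' : Real.cos (j * α - φ) * Real.cos ((j + 1 : ℕ) * α - φ) < 0 := by
        by_contra! hc
        nlinarith [mul_nonneg (mul_self_nonneg r) hc]
      have := floor_lt_floor_of_cos_mul_cos_neg hle h'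
      have h4 : g j + 1 ≤ g (j + 1) := this
      have : ((g j + 1 : ℤ) : ℝ) ≤ g (j + 1) := by exact_mod_cast h4
      push_cast at this
      linarith
    · have h4 : g j ≤ g (j + 1) := Int.floor_mono (by gcongr)
      have : (g j : ℝ) ≤ g (j + 1) := by exact_mod_cast h4
      linarith
  refine (Finset.sum_le_sum fun j _ => hstep j).trans ?_
  rw [Finset.sum_range_sub (fun j => (g j : ℝ))]
  have h1 : (g N : ℝ) ≤ (N * α - φ) / Real.pi + 1 / 2 := Int.floor_le _
  have h2 : ((0 : ℕ) * α - φ) / Real.pi + 1 / 2 < (g 0 : ℝ) + 1 := Int.lt_floor_add_one _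
  have h3 : (N * α - φ) / Real.pi - ((0 : ℕ) * α - φ) / Real.pi = N * α / Real.pi := by
    push_cast; ring
  linarith

variable {n : ℕ}

/-- The points of the sphere at which the two linear forms have strictly opposite signs. -/
def openWedge (x z : EuclideanSpace ℝ (Fin n)) : Set (UnitSphere n) :=
  {v | inner ℝ (v : EuclideanSpace ℝ (Fin n)) x * inner ℝ (v : EuclideanSpace ℝ (Fin n)) z < 0}

theorem measurableSet_openWedge (x z : EuclideanSpace ℝ (Fin n)) :
    MeasurableSet (openWedge x z) := by
  have : IsOpen (openWedge x z) := isOpen_lt (by fun_prop) continuous_const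
  exact this.measurableSet

theorem openWedge_comm (x z : EuclideanSpace ℝ (Fin n)) : openWedge x z = openWedge z x := by
  ext v; simp only [openWedge, Set.mem_ofPred_eq, mul_comm]

theorem openWedge_smul (x z : EuclideanSpace ℝ (Fin n)) {r s : ℝ} (hr : 0 < r) (hs : 0 < s) :
    openWedge (r • x) (s • z) = openWedge x z := by
  ext v
  simp only [openWedge, Set.mem_ofPred_eq, real_inner_smul_right]
  have : ∀ a b : ℝ, r * a * (s * b) = (r * s) * (a * b) := fun a b => by ring
  rw [this]
  refine ⟨fun h => ?_, mul_neg_of_pos_of_neg (mul_pos hr hs)⟩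
  by_contra! h'
  exact h.not_ge (mul_nonneg (mul_pos hr hs).le h')

open scoped Pointwise in
-- The spherical measure of a set is a multiple of the volume of its cone. In this form the cone no
-- longer mentions the sphere, so linear isometries act on it directly.
theorem Ioo_smul_openWedge (x z : EuclideanSpace ℝ (Fin n)) :
    Set.Ioo (0 : ℝ) 1 • ((↑) '' openWedge x z : Set (EuclideanSpace ℝ (Fin n))) =
      {w | ‖w‖ < 1 ∧ inner ℝ w x * inner ℝ w z < 0} := by
  have hscale : ∀ (t : ℝ) (w : EuclideanSpace ℝ (Fin n)), inner ℝ (t • w) x * inner ℝ (t • w) z =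
      t * t * (inner ℝ w x * inner ℝ w z) := fun t w => by
    rw [real_inner_smul_left, real_inner_smul_left]; ring
  ext w
  constructor
  · rintro ⟨t, ht, _, ⟨v, hv, rfl⟩, rfl⟩
    have hv1 : ‖(v : EuclideanSpace ℝ (Fin n))‖ = 1 := by simp
    refine ⟨?_, ?_⟩
    · simp only [norm_smul, hv1, Real.norm_eq_abs, abs_of_pos ht.1, mul_one]
      exact ht.2
    · simp only [hscale]
      exact mul_neg_of_pos_of_neg (mul_pos ht.1 ht.1) hv
  · rintro ⟨hw1, hw⟩
    have hw0 : w ≠ 0 := by rintro rfl; simp at hw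
    have hn0 : 0 < ‖w‖ := norm_pos_iff.2 hw0
    refine ⟨‖w‖, ⟨hn0, hw1⟩, ‖w‖⁻¹ • w, ⟨⟨‖w‖⁻¹ • w, ?_⟩, ?_, rfl⟩, ?_⟩
    · simp [norm_smul, hn0.ne']
    · change inner ℝ (‖w‖⁻¹ • w) x * inner ℝ (‖w‖⁻¹ • w) z < 0
      rw [hscale]
      exact mul_neg_of_pos_of_neg (by positivity) hw
    · simp [smul_smul, hn0.ne']

theorem uniform_openWedge_map (f : EuclideanSpace ℝ (Fin n) ≃ₗᵢ[ℝ] EuclideanSpace ℝ (Fin n))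
    (x z : EuclideanSpace ℝ (Fin n)) :
    uniform n (openWedge (f x) (f z)) = uniform n (openWedge x z) := by
  have key : (volume : Measure (EuclideanSpace ℝ (Fin n)))
        {w | ‖w‖ < 1 ∧ inner ℝ w (f x) * inner ℝ w (f z) < 0} =
      volume {w : EuclideanSpace ℝ (Fin n) | ‖w‖ < 1 ∧ inner ℝ w x * inner ℝ w z < 0} := by
    have hmeas : MeasurableSet
        {w : EuclideanSpace ℝ (Fin n) | ‖w‖ < 1 ∧ inner ℝ w (f x) * inner ℝ w (f z) < 0} := by
      have h1 : IsOpen {w : EuclideanSpace ℝ (Fin n) | ‖w‖ < 1} :=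
        isOpen_lt (by fun_prop) continuous_const
      have h2 : IsOpen
          {w : EuclideanSpace ℝ (Fin n) | inner ℝ w (f x) * inner ℝ w (f z) < 0} :=
        isOpen_lt (by fun_prop) continuous_const
      exact (h1.inter h2).measurableSet
    rw [← f.measurePreserving.measure_preimage hmeas.nullMeasurableSet]
    congr 1
    ext w
    simp
  simp only [uniform, Measure.smul_apply,
    Measure.toSphere_apply' _ (measurableSet_openWedge _ _), Ioo_smul_openWedge, key]

/-- Rotating a wedge with equal sides does not change its measure: if `v`, `w` are symmetric with
respect to `y`, the wedges between `v`, `y` and between `y`, `w` have the same measure. -/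
theorem uniform_openWedge_eq_of_symm {v y w : EuclideanSpace ℝ (Fin n)} (hvw : ‖v‖ = ‖w‖)
    (hy : inner ℝ v y = inner ℝ w y) :
    uniform n (openWedge y w) = uniform n (openWedge v y) := by
  -- The reflection in the hyperplane orthogonal to `v - w` exchanges `v` and `w` and fixes `y`.
  have h1 := Submodule.reflection_sub hvw
  have h2 : (Submodule.span ℝ {v - w})ᗮ.reflection y = y := by
    apply Submodule.reflection_mem_subspace_eq_self
    rw [Submodule.mem_orthogonal_singleton_iff_inner_right, inner_sub_left, hy, sub_self]
  rw [openWedge_comm y w, ← uniform_openWedge_map (Submodule.span ℝ {v - w})ᗮ.reflection v y,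
    h1, h2]

/-- Turning repeatedly by `α` gives `N` wedges of equal measure, while each point lies in at most
`Nα/π + 1` of them. Integrating this count, dividing by `N` and letting `N` grow gives the bound
without polar coordinates. -/
theorem uniform_openWedge_orthonormal_le [IsProbabilityMeasure (uniform n)]
    {e f : EuclideanSpace ℝ (Fin n)} (he : ‖e‖ = 1) (hf : ‖f‖ = 1) (hef : inner ℝ e f = 0)
    {α : ℝ} (hα : 0 ≤ α) :
    (uniform n).real (openWedge e (Real.cos α • e + Real.sin α • f)) ≤ α / Real.pi := by
  let u : ℝ → EuclideanSpace ℝ (Fin n) := fun t => Real.cos t • e + Real.sin t • f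
  have hfe : inner ℝ f e = 0 := by rw [real_inner_comm]; exact hef
  have huu : ∀ s t, inner ℝ (u s) (u t) = Real.cos (s - t) := by
    intro s t
    simp only [u, inner_add_left, inner_add_right, real_inner_smul_left, real_inner_smul_right,
      hef, hfe, real_inner_self_eq_norm_sq, he, hf, Real.cos_sub]
    ring
  have hnorm : ∀ t, ‖u t‖ = 1 := by
    intro t
    have := huu t t
    rw [real_inner_self_eq_norm_sq, sub_self, Real.cos_zero] at this
    exact (pow_eq_one_iff_of_nonneg (norm_nonneg _) two_ne_zero).1 this
  let S : ℕ → Set (UnitSphere n) := fun j => openWedge (u (j * α)) (u ((j + 1 : ℕ) * α))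
  have hS : ∀ j, (uniform n).real (S j) =
      (uniform n).real (openWedge e (Real.cos α • e + Real.sin α • f)) := by
    intro j
    induction j with
    | zero => simp [S, u]
    | succ j ih =>
      rw [← ih]
      simp only [measureReal_def, S]
      rw [uniform_openWedge_eq_of_symm]
      · rw [hnorm, hnorm]
      · rw [huu, huu, ← Real.cos_neg]
        congr 1
        push_cast
        ring
  have hcount : ∀ N : ℕ, ∀ v : UnitSphere n,
      ∑ j ∈ Finset.range N, (S j).indicator (1 : UnitSphere n → ℝ) v ≤ N * α / Real.pi + 1 := by
    intro N v
    -- The polar form of the projection of `v` to the plane of `e` and `f` turns `⟨v, u t⟩` into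
    -- `‖c‖ cos (t - arg c)`.
    let c : ℂ := ⟨inner ℝ (v : EuclideanSpace ℝ (Fin n)) e,
      inner ℝ (v : EuclideanSpace ℝ (Fin n)) f⟩
    have hval : ∀ t, inner ℝ (v : EuclideanSpace ℝ (Fin n)) (u t) = ‖c‖ * Real.cos (t - c.arg) := by
      intro t
      rw [Real.cos_sub]
      have h1 : ‖c‖ * Real.cos c.arg = inner ℝ (v : EuclideanSpace ℝ (Fin n)) e :=
        Complex.norm_mul_cos_arg c
      have h2 : ‖c‖ * Real.sin c.arg = inner ℝ (v : EuclideanSpace ℝ (Fin n)) f :=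
        Complex.norm_mul_sin_arg c
      simp only [u, inner_add_right, real_inner_smul_right, ← h1, ← h2]
      ring
    refine le_trans (le_of_eq ?_) (sum_sign_changes_le (r := ‖c‖) (φ := c.arg) hα N)
    refine Finset.sum_congr rfl fun j _ => ?_
    simp only [S, openWedge, Set.indicator_apply, Set.mem_ofPred_eq, hval, Pi.one_apply]
  have hN : ∀ N : ℕ, N * (uniform n).real (openWedge e (Real.cos α • e + Real.sin α • f)) ≤
      N * α / Real.pi + 1 := by
    intro N
    have hSm : ∀ j, MeasurableSet (S j) := fun j => measurableSet_openWedge _ _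
    have hint : ∀ j, Integrable ((S j).indicator (1 : UnitSphere n → ℝ)) (uniform n) := fun j =>
      (integrable_const (1 : ℝ)).indicator (hSm j)
    have h1 : ∫ v, ∑ j ∈ Finset.range N, (S j).indicator (1 : UnitSphere n → ℝ) v ∂(uniform n) =
        N * (uniform n).real (openWedge e (Real.cos α • e + Real.sin α • f)) := by
      rw [integral_finsetSum _ fun j _ => hint j]
      simp_rw [integral_indicator_one (hSm _), hS]
      simp
    rw [← h1]
    refine (integral_mono (integrable_finsetSum _ fun j _ => hint j) (integrable_const _)
      (hcount N)).trans ?_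
    simp
  by_contra! hlt
  obtain ⟨N, hNlt⟩ := exists_nat_gt
    (1 / ((uniform n).real (openWedge e (Real.cos α • e + Real.sin α • f)) - α / Real.pi))
  rw [div_lt_iff₀ (sub_pos.2 hlt), mul_sub] at hNlt
  have := hN N
  rw [mul_div_assoc] at this
  linarith

theorem uniform_openWedge_le [IsProbabilityMeasure (uniform n)]
    {x z : EuclideanSpace ℝ (Fin n)} (hx : x ≠ 0) (hz : z ≠ 0)
    (hangle : InnerProductGeometry.angle x z < Real.pi) :
    (uniform n).real (openWedge x z) ≤ InnerProductGeometry.angle x z / Real.pi := by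
  set α := InnerProductGeometry.angle x z with hα
  have hα0 : 0 ≤ α := InnerProductGeometry.angle_nonneg x z
  have hx0 : 0 < ‖x‖⁻¹ := by simpa using hx
  have hz0 : 0 < ‖z‖⁻¹ := by simpa using hz
  have hnx : ‖‖x‖⁻¹ • x‖ = 1 := by rw [norm_smul]; simp [hx]
  have hnz : ‖‖z‖⁻¹ • z‖ = 1 := by rw [norm_smul]; simp [hz]
  rw [← openWedge_smul x z hx0 hz0]
  set e := ‖x‖⁻¹ • x with he
  set y := ‖z‖⁻¹ • z with hy
  have hey : inner ℝ e y = Real.cos α := by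
    rw [hα, InnerProductGeometry.cos_angle, he, hy, real_inner_smul_left, real_inner_smul_right]
    field_simp
  -- Gram–Schmidt divides by `sin α`, so the empty wedge `α = 0` is treated separately.
  rcases hα0.eq_or_lt with h0 | hpos
  · have heq : e = y := by
      rw [← h0, Real.cos_zero] at hey
      exact (inner_eq_one_iff_of_norm_eq_one hnx hnz).1 hey
    have : openWedge e y = ∅ := by
      ext v
      simp [openWedge, heq, mul_self_nonneg]
    rw [this]
    simp only [measureReal_empty]
    positivity
  · have hsin : 0 < Real.sin α := Real.sin_pos_of_pos_of_lt_pi hpos hangle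
    set f := (Real.sin α)⁻¹ • (y - Real.cos α • e) with hf
    have hyf : Real.cos α • e + Real.sin α • f = y := by
      rw [hf, smul_inv_smul₀ hsin.ne']; abel
    have hef : inner ℝ e f = 0 := by
      rw [hf, real_inner_smul_right, inner_sub_right, hey, real_inner_smul_right,
        real_inner_self_eq_norm_sq, hnx]
      ring
    have hff : ‖f‖ = 1 := by
      have h1 : inner ℝ y y = (1 : ℝ) := by rw [real_inner_self_eq_norm_sq, hnz]; norm_num
      have hee : inner ℝ e e = (1 : ℝ) := by rw [real_inner_self_eq_norm_sq, hnx]; norm_num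
      rw [← hyf] at h1
      have hfe : inner ℝ f e = 0 := by rw [real_inner_comm]; exact hef
      simp only [inner_add_left, inner_add_right, real_inner_smul_left, real_inner_smul_right,
        hef, hfe, hee] at h1
      rw [real_inner_self_eq_norm_sq] at h1
      have h2 : Real.sin α ^ 2 * ‖f‖ ^ 2 = Real.sin α ^ 2 * 1 := by
        nlinarith [Real.sin_sq_add_cos_sq α]
      exact (pow_eq_one_iff_of_nonneg (norm_nonneg _) two_ne_zero).1
        (mul_left_cancel₀ (by positivity) h2)
    rw [← hyf]
    exact uniform_openWedge_orthonormal_le hnx hff hef hα0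

/-- The open hemisphere with a given normal vector. -/
def hemisphere (x : EuclideanSpace ℝ (Fin n)) : Set (UnitSphere n) :=
  {v | 0 < inner ℝ (v : EuclideanSpace ℝ (Fin n)) x}

theorem measurableSet_hemisphere (x : EuclideanSpace ℝ (Fin n)) :
    MeasurableSet (hemisphere x) := by
  have : IsOpen (hemisphere x) := isOpen_lt continuous_const (by fun_prop)
  exact this.measurableSet

open scoped Pointwise in
-- The cone over the equator lies in the orthogonal complement of `x`, a proper subspace and hence
-- Lebesgue null.
theorem uniform_equator_eq_zero {x : EuclideanSpace ℝ (Fin n)} (hx : x ≠ 0) :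
    uniform n {v | inner ℝ (v : EuclideanSpace ℝ (Fin n)) x = 0} = 0 := by
  have hm : MeasurableSet
      {v : UnitSphere n | inner ℝ (v : EuclideanSpace ℝ (Fin n)) x = 0} := by
    have : IsClosed {v : UnitSphere n | inner ℝ (v : EuclideanSpace ℝ (Fin n)) x = 0} :=
      isClosed_eq (by fun_prop) continuous_const
    exact this.measurableSet
  rw [uniform, Measure.smul_apply, Measure.toSphere_apply' _ hm]
  have h0 : volume (Set.Ioo (0 : ℝ) 1 • ((↑) '' {v : UnitSphere n |
      inner ℝ (v : EuclideanSpace ℝ (Fin n)) x = 0} : Set (EuclideanSpace ℝ (Fin n)))) = 0 := by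
    refine measure_mono_null ?_
      (Measure.addHaar_submodule volume (Submodule.span ℝ {x})ᗮ ?_)
    · rintro _ ⟨t, -, _, ⟨v, hv, rfl⟩, rfl⟩
      refine Submodule.smul_mem _ t ?_
      rw [Submodule.mem_orthogonal_singleton_iff_inner_left]
      exact hv
    · intro h
      have : x ∈ (Submodule.span ℝ {x})ᗮ := h ▸ Submodule.mem_top
      rw [Submodule.mem_orthogonal_singleton_iff_inner_left, inner_self_eq_zero] at this
      exact hx this
  rw [h0]; simp

theorem openWedge_subset_symmDiff (x z : EuclideanSpace ℝ (Fin n)) :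
    openWedge x z ⊆ symmDiff (hemisphere x) (hemisphere z) := by
  intro v hv
  simp only [Set.mem_symmDiff, hemisphere, Set.mem_ofPred_eq, not_lt]
  rcases mul_neg_iff.1 (show _ * _ < (0 : ℝ) from hv) with h | h
  · exact Or.inl ⟨h.1, h.2.le⟩
  · exact Or.inr ⟨h.2, h.1.le⟩

/-- Symmetric differences are the form suited to counting traces; they exceed open wedges only by
parts of two equators. -/
theorem uniform_symmDiff_hemisphere_le [IsProbabilityMeasure (uniform n)]
    {x z : EuclideanSpace ℝ (Fin n)} (hx : x ≠ 0) (hz : z ≠ 0)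
    (hangle : InnerProductGeometry.angle x z < Real.pi) :
    (uniform n).real (symmDiff (hemisphere x) (hemisphere z)) ≤
      InnerProductGeometry.angle x z / Real.pi := by
  refine le_trans ?_ (uniform_openWedge_le hx hz hangle)
  have hsub : symmDiff (hemisphere x) (hemisphere z) ⊆ openWedge x z ∪
      ({v | inner ℝ (v : EuclideanSpace ℝ (Fin n)) x = 0} ∪
        {v | inner ℝ (v : EuclideanSpace ℝ (Fin n)) z = 0}) := by
    intro v hv
    simp only [Set.mem_symmDiff, hemisphere, Set.mem_ofPred_eq, not_lt] at hv
    rcases hv with ⟨h1, h2⟩ | ⟨h1, h2⟩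
    · rcases h2.eq_or_lt with h | h
      · exact Or.inr (Or.inr h)
      · exact Or.inl (mul_neg_of_pos_of_neg h1 h)
    · rcases h2.eq_or_lt with h | h
      · exact Or.inr (Or.inl h)
      · exact Or.inl (mul_neg_of_neg_of_pos h h1)
  have hnull : uniform n ({v | inner ℝ (v : EuclideanSpace ℝ (Fin n)) x = 0} ∪
        {v | inner ℝ (v : EuclideanSpace ℝ (Fin n)) z = 0}) = 0 :=
    measure_union_null (uniform_equator_eq_zero hx) (uniform_equator_eq_zero hz)
  refine ENNReal.toReal_mono (measure_ne_top _ _) ((measure_mono hsub).trans ?_)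
  refine (measure_union_le _ _).trans ?_
  rw [hnull, add_zero]

open Filter Topology in
/-- The trace of a wedge on a finite set of points is contained in the open wedge of all nearby
pairs of suitable normal vectors. -/
theorem exists_mem_dense_wedge_inter_subset {ι : Type*} [Finite ι] (a : ι → UnitSphere n)
    {D : Set (EuclideanSpace ℝ (Fin n) × EuclideanSpace ℝ (Fin n))} (hD : Dense D) {θ : ℝ}
    {x z : EuclideanSpace ℝ (Fin n)} (hx : x ≠ 0) (hz : z ≠ 0)
    (hangle : InnerProductGeometry.angle x z < θ) :
    ∃ p ∈ D, p.1 ≠ 0 ∧ p.2 ≠ 0 ∧ InnerProductGeometry.angle p.1 p.2 < θ ∧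
      ∀ i, a i ∈ wedge x z → a i ∈ openWedge p.1 p.2 := by
  have hgood : ∀ᶠ p in 𝓝 (x, z), p.1 ≠ 0 ∧ p.2 ≠ 0 ∧
      InnerProductGeometry.angle p.1 p.2 < θ := by
    have h1 : ∀ᶠ p : EuclideanSpace ℝ (Fin n) × EuclideanSpace ℝ (Fin n) in 𝓝 (x, z), p.1 ≠ 0 :=
      continuousAt_fst.eventually_ne hx
    have h2 : ∀ᶠ p : EuclideanSpace ℝ (Fin n) × EuclideanSpace ℝ (Fin n) in 𝓝 (x, z), p.2 ≠ 0 :=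
      continuousAt_snd.eventually_ne hz
    have h3 := (InnerProductGeometry.continuousAt_angle (x := (x, z)) hx hz).eventually_lt_const
      hangle
    filter_upwards [h1, h2, h3] with p h1 h2 h3 using ⟨h1, h2, h3⟩
  -- Pushing the normals apart makes weakly opposite signs strictly opposite: `(p - tq)(q - tp) = (1
  -- + t²)pq - t(p² + q²) < 0` when `pq ≤ 0` and `p`, `q` are not both zero.
  have hpath : Tendsto (fun t : ℝ => (x - t • z, z - t • x)) (𝓝[>] 0) (𝓝 (x, z)) := by
    have : Continuous fun t : ℝ => (x - t • z, z - t • x) := by fun_prop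
    simpa using (this.tendsto 0).mono_left nhdsWithin_le_nhds
  have hwedge : ∀ᶠ t in 𝓝[>] (0 : ℝ), ∀ i, a i ∈ wedge x z →
      a i ∈ openWedge (x - t • z) (z - t • x) := by
    rw [eventually_all]
    intro i
    by_cases hi : a i ∈ wedge x z
    swap
    · exact Eventually.of_forall fun t h => (hi h).elim
    set p : ℝ := inner ℝ (a i : EuclideanSpace ℝ (Fin n)) x with hp
    set q : ℝ := inner ℝ (a i : EuclideanSpace ℝ (Fin n)) z with hq
    have hpq : SignType.sign p ≠ SignType.sign q := hi
    have hprod : p * q ≤ 0 := by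
      by_contra! h
      rcases pos_and_pos_or_neg_and_neg_of_mul_pos h with h | h
      · exact hpq (by rw [sign_pos h.1, sign_pos h.2])
      · exact hpq (by rw [sign_neg h.1, sign_neg h.2])
    have hne : 0 < p ^ 2 + q ^ 2 := by
      by_contra! h
      have hp0 : p = 0 := by nlinarith [sq_nonneg p, sq_nonneg q]
      have hq0 : q = 0 := by nlinarith [sq_nonneg p, sq_nonneg q]
      exact hpq (by rw [hp0, hq0])
    have hlt : ∀ᶠ t in 𝓝[>] (0 : ℝ), t < 1 :=
      (eventually_lt_nhds one_pos).filter_mono nhdsWithin_le_nhds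
    filter_upwards [hlt, self_mem_nhdsWithin] with t ht ht0 _
    have ht0' : 0 < t := ht0
    change inner ℝ (a i : EuclideanSpace ℝ (Fin n)) (x - t • z) *
      inner ℝ (a i : EuclideanSpace ℝ (Fin n)) (z - t • x) < 0
    simp only [inner_sub_right, real_inner_smul_right, ← hp, ← hq]
    nlinarith [mul_pos ht0' hne, mul_nonneg (sq_nonneg t) (neg_nonneg.2 hprod)]
  obtain ⟨t, htgood, htwedge⟩ := ((hpath.eventually hgood.eventually_nhds).and hwedge).exists
  -- For fixed `t` the strict inequalities at finitely many points are open conditions, so a nearby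
  -- pair in `D` inherits them.
  have hopen : ∀ᶠ p in 𝓝 (x - t • z, z - t • x), ∀ i, a i ∈ wedge x z →
      a i ∈ openWedge p.1 p.2 := by
    rw [eventually_all]
    intro i
    by_cases hi : a i ∈ wedge x z
    swap
    · exact Eventually.of_forall fun t h => (hi h).elim
    have hcont : Continuous fun p : EuclideanSpace ℝ (Fin n) × EuclideanSpace ℝ (Fin n) =>
        inner ℝ (a i : EuclideanSpace ℝ (Fin n)) p.1 *
          inner ℝ (a i : EuclideanSpace ℝ (Fin n)) p.2 := by fun_prop
    have hmem : inner ℝ (a i : EuclideanSpace ℝ (Fin n)) (x - t • z) *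
      inner ℝ (a i : EuclideanSpace ℝ (Fin n)) (z - t • x) < 0 := htwedge i hi
    filter_upwards [hcont.continuousAt.eventually_lt_const hmem] with p hp _ using hp
  obtain ⟨p, ⟨⟨h1, h2, h3⟩, h4⟩, hpD⟩ :=
    ((htgood.and hopen).and_frequently
      (mem_closure_iff_frequently.1 (hD (x - t • z, z - t • x)))).exists
  exact ⟨p, hpD, h1, h2, h3, h4⟩

end Geometry

/-! ### Symmetrization and a uniform deviation bound -/

section Symmetrization

variable {S κ : Type*} {m : ℕ}

/-- The number of points of a finite sample that lie in a set. -/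
noncomputable def hits (V : Set S) (a : Fin m → S) : ℝ :=
  ∑ i, V.indicator (1 : S → ℝ) (a i)

theorem hits_nonneg (V : Set S) (a : Fin m → S) : 0 ≤ hits V a :=
  Finset.sum_nonneg fun _ _ => Set.indicator_nonneg (fun _ _ => zero_le_one) _

theorem hits_mono {V W : Set S} {a : Fin m → S} (h : ∀ i, a i ∈ V → a i ∈ W) :
    hits V a ≤ hits W a := by
  refine Finset.sum_le_sum fun i _ => ?_
  by_cases hi : a i ∈ V
  · simp [hi, h i hi]
  · rw [Set.indicator_of_notMem hi]
    exact Set.indicator_nonneg (fun _ _ => zero_le_one) _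

/-- Exchange the two members of a pair unless the given bit is set. -/
def swapUnless (b : Bool) (p : S × S) : S × S := if b then p else p.swap

/-- The difference of the numbers of hits of a set by the first and by the second coordinates. -/
noncomputable def hitsDiff (V : Set S) (p : Fin m → S × S) : ℝ :=
  ∑ i, (V.indicator (1 : S → ℝ) (p i).1 - V.indicator (1 : S → ℝ) (p i).2)

open Classical in
/-- Among all ways to exchange members of `m` fixed pairs, those that give a large difference of
hits for some set of the family are few if the family has few traces on the points. -/
theorem card_swaps_le {V : κ → Set S} (hm : 0 < m) {t : ℝ} (ht : 0 ≤ t) (p : Fin m → S × S)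
    (T : Finset (Finset (Fin m × Bool)))
    (hT : ∀ k, (Finset.univ.filter fun j : Fin m × Bool =>
      (if j.2 then (p j.1).1 else (p j.1).2) ∈ V k) ∈ T) :
    ((Finset.univ.filter fun s : Fin m → Bool =>
      ∃ k, t < hitsDiff (V k) fun i => swapUnless (s i) (p i)).card : ℝ) ≤
      T.card * (2 ^ m * Real.exp (-(t ^ 2 / (2 * m)))) := by
  -- The differences of hits depend on `k` only through the trace, so the union bound runs over `T`
  -- instead of `κ`.
  let d : Finset (Fin m × Bool) → Fin m → ℝ := fun τ i =>
    (if (i, true) ∈ τ then 1 else 0) - (if (i, false) ∈ τ then 1 else 0)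
  have hd : ∀ τ i, |d τ i| ≤ 1 := by
    intro τ i
    simp only [d]
    split_ifs <;> norm_num
  have hsub : (Finset.univ.filter fun s : Fin m → Bool =>
      ∃ k, t < hitsDiff (V k) fun i => swapUnless (s i) (p i)) ⊆
      T.biUnion fun τ => Finset.univ.filter fun s : Fin m → Bool =>
        t < ∑ i, (if s i then d τ i else - d τ i) := by
    intro s hs
    obtain ⟨k, hk⟩ := (Finset.mem_filter.1 hs).2
    refine Finset.mem_biUnion.2 ⟨_, hT k, Finset.mem_filter.2 ⟨Finset.mem_univ _, ?_⟩⟩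
    refine hk.trans_le (le_of_eq (Finset.sum_congr rfl fun i _ => ?_))
    cases h : s i <;> simp [h, d, swapUnless, Set.indicator_apply]
  calc _ ≤ ((T.biUnion fun τ => Finset.univ.filter fun s : Fin m → Bool =>
        t < ∑ i, (if s i then d τ i else - d τ i)).card : ℝ) := by
        exact_mod_cast Finset.card_le_card hsub
    _ ≤ ∑ τ ∈ T, ((Finset.univ.filter fun s : Fin m → Bool =>
        t < ∑ i, (if s i then d τ i else - d τ i)).card : ℝ) := by
        exact_mod_cast Finset.card_biUnion_le
    _ ≤ ∑ _τ ∈ T, 2 ^ m * Real.exp (-(t ^ 2 / (2 * m))) :=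
        Finset.sum_le_sum fun τ _ => card_signs_le hm (d τ) (hd τ) ht
    _ = _ := by rw [Finset.sum_const, nsmul_eq_mul]

variable [MeasurableSpace S]

theorem measurable_hits {V : Set S} (hV : MeasurableSet V) :
    Measurable (hits V : (Fin m → S) → ℝ) :=
  Finset.measurable_fun_sum _ fun i _ =>
    (measurable_one.indicator hV).comp (measurable_pi_apply i)

theorem integrable_indicator_eval (σ : Measure S) [IsProbabilityMeasure σ] {V : Set S}
    (hV : MeasurableSet V) (i : Fin m) :
    Integrable (fun a : Fin m → S => V.indicator (1 : S → ℝ) (a i)) (Measure.pi fun _ => σ) := by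
  have h : Integrable (V.indicator (1 : S → ℝ)) σ := (integrable_const (1 : ℝ)).indicator hV
  exact (measurePreserving_eval (fun _ : Fin m => σ) i).integrable_comp_of_integrable h

theorem integrable_hits (σ : Measure S) [IsProbabilityMeasure σ] {V : Set S}
    (hV : MeasurableSet V) :
    Integrable (hits V : (Fin m → S) → ℝ) (Measure.pi fun _ => σ) := by
  exact integrable_finsetSum _ fun i _ => integrable_indicator_eval σ hV i

theorem integral_hits (σ : Measure S) [IsProbabilityMeasure σ] {V : Set S}
    (hV : MeasurableSet V) :
    ∫ a : Fin m → S, hits V a ∂(Measure.pi fun _ => σ) = m * σ.real V := by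
  unfold hits
  rw [integral_finsetSum]
  · have h : ∀ i : Fin m, ∫ a : Fin m → S, V.indicator (1 : S → ℝ) (a i) ∂(Measure.pi fun _ => σ) =
        σ.real V := fun i => by
      rw [integral_comp_eval (μ := fun _ : Fin m => σ) (i := i) (f := V.indicator (1 : S → ℝ))
        (measurable_one.indicator hV).aestronglyMeasurable, integral_indicator_one hV]
    simp [h]
  · exact fun i _ => integrable_indicator_eval σ hV i

/-- Markov's inequality with mean at most `ε * m`. The level `3/2` leaves a gap `ε * m / 2` below `2
* (ε * m)`, and no lower bound on `m` beyond positivity is needed. -/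
theorem one_third_le_measure_hits_lt (σ : Measure S) [IsProbabilityMeasure σ] {V : Set S}
    (hV : MeasurableSet V) {ε : ℝ} (hε : 0 < ε) (hm : 0 < m) (hVε : σ.real V ≤ ε) :
    (3 : ℝ≥0∞)⁻¹ ≤ (Measure.pi fun _ : Fin m => σ) {a | hits V a < 3 / 2 * (ε * m)} := by
  have hm0 : (0 : ℝ) < m := by exact_mod_cast hm
  have hpos : 0 < ε * m := mul_pos hε hm0
  have hmarkov := mul_meas_ge_le_integral_of_nonneg (Filter.Eventually.of_forall (hits_nonneg V))
    (integrable_hits (m := m) σ hV) (3 / 2 * (ε * m))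
  rw [integral_hits σ hV] at hmarkov
  have hle : (Measure.pi fun _ : Fin m => σ).real {a | 3 / 2 * (ε * m) ≤ hits V a} ≤ 2 / 3 := by
    by_contra! h
    nlinarith
  have hmeas : MeasurableSet {a : Fin m → S | hits V a < 3 / 2 * (ε * m)} :=
    measurableSet_lt (measurable_hits hV) measurable_const
  have hcompl := probReal_compl_eq_one_sub (μ := Measure.pi fun _ : Fin m => σ) hmeas
  have hset : {a : Fin m → S | hits V a < 3 / 2 * (ε * m)}ᶜ = {a | 3 / 2 * (ε * m) ≤ hits V a} := by
    ext a; simp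
  rw [hset] at hcompl
  rw [← ENNReal.toReal_le_toReal (by simp) (measure_ne_top _ _), ENNReal.toReal_inv]
  change _ ≤ (Measure.pi fun _ : Fin m => σ).real _
  norm_num
  linarith

variable [Countable κ]

/-- Comparison of the deviation of an empirical measure from its mean with the deviation between two
independent empirical measures. -/
theorem measure_exists_hits_gt_le (σ : Measure S) [IsProbabilityMeasure σ] {V : κ → Set S}
    (hV : ∀ k, MeasurableSet (V k)) {ε : ℝ} (hε : 0 < ε) (hm : 0 < m)
    (hVε : ∀ k, σ.real (V k) ≤ ε) :
    (Measure.pi fun _ : Fin m => σ) {a | ∃ k, 2 * (ε * m) < hits (V k) a} ≤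
      3 * ((Measure.pi fun _ : Fin m => σ).prod (Measure.pi fun _ : Fin m => σ))
        {p | ∃ k, ε * m / 2 < hits (V k) p.1 - hits (V k) p.2} := by
  set μ := Measure.pi fun _ : Fin m => σ with hμ
  have hB : MeasurableSet {a : Fin m → S | ∃ k, 2 * (ε * m) < hits (V k) a} := by
    rw [Set.ofPred_exists]
    exact MeasurableSet.iUnion fun k => measurableSet_lt measurable_const (measurable_hits (hV k))
  have hC : MeasurableSet {p : (Fin m → S) × (Fin m → S) |
      ∃ k, ε * m / 2 < hits (V k) p.1 - hits (V k) p.2} := by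
    rw [Set.ofPred_exists]
    exact MeasurableSet.iUnion fun k => measurableSet_lt measurable_const
      (((measurable_hits (hV k)).comp measurable_fst).sub
        ((measurable_hits (hV k)).comp measurable_snd))
  rw [Measure.prod_apply hC]
  have hle : ∫⁻ _ in {a : Fin m → S | ∃ k, 2 * (ε * m) < hits (V k) a}, (3 : ℝ≥0∞)⁻¹ ∂μ ≤
      ∫⁻ a, μ (Prod.mk a ⁻¹' {p : (Fin m → S) × (Fin m → S) |
        ∃ k, ε * m / 2 < hits (V k) p.1 - hits (V k) p.2}) ∂μ := by
    rw [← lintegral_indicator hB]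
    refine lintegral_mono fun a => ?_
    by_cases ha : a ∈ {a : Fin m → S | ∃ k, 2 * (ε * m) < hits (V k) a}
    · rw [Set.indicator_of_mem ha]
      -- The index `k` depends on the first sample only, so the Markov bound applies to the
      -- independent second sample.
      obtain ⟨k, hk⟩ := ha
      refine (one_third_le_measure_hits_lt (m := m) σ (hV k) hε hm (hVε k)).trans
        (measure_mono fun a' ha' => ⟨k, ?_⟩)
      have h1 : hits (V k) a' < 3 / 2 * (ε * m) := ha'
      change ε * m / 2 < hits (V k) a - hits (V k) a'
      linarith
    · rw [Set.indicator_of_notMem ha]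
      exact zero_le
  rw [lintegral_const, Measure.restrict_apply_univ] at hle
  calc μ {a : Fin m → S | ∃ k, 2 * (ε * m) < hits (V k) a}
      = 3 * ((3 : ℝ≥0∞)⁻¹ * μ {a : Fin m → S | ∃ k, 2 * (ε * m) < hits (V k) a}) := by
        rw [← mul_assoc (3 : ℝ≥0∞), ENNReal.mul_inv_cancel (by simp) (by simp), one_mul]
    _ ≤ _ := by gcongr

theorem measurePreserving_swapUnless (σ : Measure S) [IsProbabilityMeasure σ] (b : Bool) :
    MeasurePreserving (swapUnless b) (σ.prod σ) (σ.prod σ) := by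
  cases b
  · exact Measure.measurePreserving_swap
  · exact MeasurePreserving.id _

theorem measurable_hitsDiff {V : Set S} (hV : MeasurableSet V) :
    Measurable (hitsDiff V : (Fin m → S × S) → ℝ) :=
  Finset.measurable_fun_sum _ fun i _ =>
    ((measurable_one.indicator hV).comp (measurable_fst.comp (measurable_pi_apply i))).sub
      ((measurable_one.indicator hV).comp (measurable_snd.comp (measurable_pi_apply i)))

open Classical in
-- All `2^m` swaps preserve the law of the pairs, so the probability is the mean over pairs of the
-- fraction of swaps leading to a large difference. `card_swaps_le` bounds that fraction for every
-- fixed choice of pairs.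
theorem measure_exists_hitsDiff_gt_le (σ : Measure S) [IsProbabilityMeasure σ] {V : κ → Set S}
    (hV : ∀ k, MeasurableSet (V k)) (hm : 0 < m) {t : ℝ} (ht : 0 ≤ t) (M : ℕ)
    (hM : ∀ c : Fin m × Bool → S, ∃ T : Finset (Finset (Fin m × Bool)), T.card ≤ M ∧
      ∀ k, (Finset.univ.filter fun j => c j ∈ V k) ∈ T) :
    (Measure.pi fun _ : Fin m => σ.prod σ) {p | ∃ k, t < hitsDiff (V k) p} ≤
      ENNReal.ofReal (M * Real.exp (-(t ^ 2 / (2 * m)))) := by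
  set ν := Measure.pi fun _ : Fin m => σ.prod σ with hν
  set D : Set (Fin m → S × S) := {p | ∃ k, t < hitsDiff (V k) p} with hD
  have hDm : MeasurableSet D := by
    rw [hD, Set.ofPred_exists]
    exact MeasurableSet.iUnion fun k =>
      measurableSet_lt measurable_const (measurable_hitsDiff (hV k))
  let w : (Fin m → Bool) → (Fin m → S × S) → (Fin m → S × S) :=
    fun s p i => swapUnless (s i) (p i)
  have hw : ∀ s, MeasurePreserving (w s) ν ν := fun s =>
    measurePreserving_pi _ _ fun i => measurePreserving_swapUnless σ (s i)
  have hsum : (2 : ℝ≥0∞) ^ m * ν D =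
      ∫⁻ p, ∑ s : Fin m → Bool, (w s ⁻¹' D).indicator (1 : (Fin m → S × S) → ℝ≥0∞) p ∂ν := by
    rw [lintegral_finsetSum _ fun s _ => measurable_one.indicator ((hw s).measurable hDm)]
    simp_rw [lintegral_indicator_one ((hw _).measurable hDm),
      (hw _).measure_preimage hDm.nullMeasurableSet]
    simp
  have hbound : ∀ p, ∑ s : Fin m → Bool, (w s ⁻¹' D).indicator (1 : (Fin m → S × S) → ℝ≥0∞) p ≤
      ENNReal.ofReal (2 ^ m * (M * Real.exp (-(t ^ 2 / (2 * m))))) := by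
    intro p
    obtain ⟨T, hTM, hT⟩ := hM fun j => if j.2 then (p j.1).1 else (p j.1).2
    have hcard := card_swaps_le (V := V) hm ht p T hT
    have heq : ∑ s : Fin m → Bool, (w s ⁻¹' D).indicator (1 : (Fin m → S × S) → ℝ≥0∞) p =
        ENNReal.ofReal ((Finset.univ.filter fun s : Fin m → Bool =>
          ∃ k, t < hitsDiff (V k) fun i => swapUnless (s i) (p i)).card : ℝ) := by
      rw [ENNReal.ofReal_natCast]
      simp only [Set.indicator_apply, Pi.one_apply, Finset.sum_boole]
      rfl
    rw [heq]
    refine ENNReal.ofReal_le_ofReal (hcard.trans ?_)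
    have : (T.card : ℝ) ≤ M := by exact_mod_cast hTM
    calc (T.card : ℝ) * (2 ^ m * Real.exp (-(t ^ 2 / (2 * m))))
        ≤ M * (2 ^ m * Real.exp (-(t ^ 2 / (2 * m)))) := by gcongr
      _ = _ := by ring
  have hfin : (2 : ℝ≥0∞) ^ m * ν D ≤
      2 ^ m * ENNReal.ofReal (M * Real.exp (-(t ^ 2 / (2 * m)))) := by
    rw [hsum]
    refine (lintegral_mono hbound).trans (le_of_eq ?_)
    rw [lintegral_const, measure_univ, mul_one, ENNReal.ofReal_mul (by positivity),
      ENNReal.ofReal_pow (by norm_num)]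
    simp
  exact (ENNReal.mul_le_mul_iff_right (by simp) (by simp)).1 hfin

open Classical in
/-- A one-sided uniform deviation inequality for a countable family of sets with few traces on
finite samples. -/
theorem measure_exists_hits_gt_le_exp (σ : Measure S) [IsProbabilityMeasure σ] {V : κ → Set S}
    (hV : ∀ k, MeasurableSet (V k)) {ε : ℝ} (hε : 0 < ε) (hm : 0 < m)
    (hVε : ∀ k, σ.real (V k) ≤ ε) (M : ℕ)
    (hM : ∀ c : Fin m × Bool → S, ∃ T : Finset (Finset (Fin m × Bool)), T.card ≤ M ∧
      ∀ k, (Finset.univ.filter fun j => c j ∈ V k) ∈ T) :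
    (Measure.pi fun _ : Fin m => σ) {a | ∃ k, 2 * (ε * m) < hits (V k) a} ≤
      ENNReal.ofReal (3 * (M * Real.exp (-(m * ε ^ 2 / 8)))) := by
  have hm0 : (0 : ℝ) < m := by exact_mod_cast hm
  refine (measure_exists_hits_gt_le σ hV hε hm hVε).trans ?_
  have h1 := measure_exists_hitsDiff_gt_le σ hV hm (t := ε * m / 2) (by positivity) M hM
  have h2 : ((Measure.pi fun _ : Fin m => σ).prod (Measure.pi fun _ : Fin m => σ))
        {p | ∃ k, ε * m / 2 < hits (V k) p.1 - hits (V k) p.2} =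
      (Measure.pi fun _ : Fin m => σ.prod σ) {p | ∃ k, ε * m / 2 < hitsDiff (V k) p} := by
    rw [← (measurePreserving_arrowProdEquivProdArrow S S (Fin m) (fun _ => σ)
      (fun _ => σ)).measure_preimage_equiv]
    congr 1
    ext p
    simp only [Set.mem_preimage, Set.mem_ofPred_eq, hits, hitsDiff, Finset.sum_sub_distrib]
    rfl
  rw [h2, ENNReal.ofReal_mul (by norm_num)]
  have h3 : (ε * m / 2) ^ 2 / (2 * m) = m * ε ^ 2 / 8 := by field_simp; ring
  rw [h3] at h1
  simpa using mul_le_mul_right h1 3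

end Symmetrization

/-! ### Application to wedges -/

open Classical in
/-- The symmetric differences of two hemispheres have few traces on a finite sample. -/
theorem exists_traces_symmDiff_hemisphere {n m : ℕ} {κ : Type*}
    (x z : κ → EuclideanSpace ℝ (Fin n)) (c : Fin m × Bool → UnitSphere n) :
    ∃ T : Finset (Finset (Fin m × Bool)), T.card ≤ (∑ k ∈ Finset.Iic n, (2 * m).choose k) ^ 2 ∧
      ∀ k, (Finset.univ.filter fun j => c j ∈ symmDiff (hemisphere (x k)) (hemisphere (z k))) ∈
        T := by
  let H := halfSpaceTraces fun j => (c j : EuclideanSpace ℝ (Fin n))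
  have hH : H.card ≤ ∑ k ∈ Finset.Iic n, (2 * m).choose k := by
    have := card_halfSpaceTraces_le fun j => (c j : EuclideanSpace ℝ (Fin n))
    simpa [mul_comm m 2] using this
  -- A trace of a symmetric difference is a symmetric difference of two half-space traces; hence the
  -- square.
  refine ⟨Finset.image₂ symmDiff H H, (Finset.card_image₂_le _ _ _).trans ?_, fun k => ?_⟩
  · rw [pow_two]
    exact Nat.mul_le_mul hH hH
  · refine Finset.mem_image₂.2 ⟨_, Finset.mem_filter.2 ⟨Finset.mem_univ _, x k, rfl⟩,
      _, Finset.mem_filter.2 ⟨Finset.mem_univ _, z k, rfl⟩, ?_⟩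
    ext j
    simp [Finset.mem_symmDiff, Set.mem_symmDiff, hemisphere]

theorem empirical_apply {n m : ℕ} (a : Fin m → UnitSphere n) (W : Set (UnitSphere n)) :
    empirical a W = (m : ℝ≥0∞)⁻¹ * ENNReal.ofReal (hits W a) := by
  have h0 : ∀ i, 0 ≤ W.indicator (1 : UnitSphere n → ℝ) (a i) := fun i =>
    Set.indicator_nonneg (fun _ _ => zero_le_one) _
  have h : ∀ i, Measure.dirac (a i) W =
      ENNReal.ofReal (W.indicator (1 : UnitSphere n → ℝ) (a i)) := fun i => by
    rw [Measure.dirac_apply]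
    by_cases hi : a i ∈ W <;> simp [hi]
  rw [empirical, Measure.smul_apply, Measure.finsetSum_apply, smul_eq_mul, hits,
    ENNReal.ofReal_sum_of_nonneg fun i _ => h0 i]
  simp_rw [h]

/-- With `L = 2ny + log (2/δ)` and `y = log (2em/n)`, the hypothesis gives `mε²/8 ≥ 2L`. The surplus
over `L` absorbs the factor 3: what remains is at most `3(δ/2)² ≤ δ`, as `δ ≤ 1`. -/
theorem failure_bound_le {n m : ℕ} (hn : 1 ≤ n) (hnm : n ≤ 2 * m) {θ δ : ℝ} (hθ : 0 < θ)
    (hδ : 0 < δ) (hδ1 : δ ≤ 1)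
    (hm : (m : ℝ) ≥ (4 * Real.pi / θ) ^ 2 *
      (2 * n * Real.log (2 * Real.exp 1 * m / n) + Real.log (2 / δ))) :
    3 * ((((∑ k ∈ Finset.Iic n, (2 * m).choose k) ^ 2 : ℕ) : ℝ) *
      Real.exp (-(m * (θ / Real.pi) ^ 2 / 8))) ≤ δ := by
  have hpi := Real.pi_pos
  have hn0 : (0 : ℝ) < n := by exact_mod_cast hn
  have hnm' : (n : ℝ) ≤ 2 * m := by exact_mod_cast hnm
  have hm0 : (0 : ℝ) < m := by linarith
  set K : ℝ := 2 * Real.exp 1 * m / n with hK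
  have hK1 : 1 ≤ K := by
    rw [hK, one_le_div hn0]
    nlinarith [Real.add_one_le_exp (1 : ℝ)]
  have hK0 : 0 < K := by linarith
  set y := Real.log K with hy
  have hy0 : 0 ≤ y := Real.log_nonneg hK1
  have hM : (((∑ k ∈ Finset.Iic n, (2 * m).choose k) ^ 2 : ℕ) : ℝ) ≤ Real.exp (2 * n * y) := by
    have h1 := sum_choose_le_rpow hn hnm
    have h2 : Real.exp 1 * ((2 * m : ℕ) : ℝ) / n = Real.exp y := by
      rw [hy, Real.exp_log hK0, hK]; push_cast; ring
    rw [h2, ← Real.exp_nat_mul] at h1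
    rw [Nat.cast_pow]
    calc _ ≤ Real.exp (n * y) ^ 2 := pow_le_pow_left₀ (Nat.cast_nonneg _) h1 2
      _ = _ := by rw [← Real.exp_nat_mul]; congr 1; push_cast; ring
  have hexp : Real.exp (-(m * (θ / Real.pi) ^ 2 / 8)) ≤
      Real.exp (-(2 * (2 * n * y + Real.log (2 / δ)))) := by
    apply Real.exp_le_exp.2
    have h3 : (4 * Real.pi / θ) ^ 2 * (2 * n * y + Real.log (2 / δ)) * ((θ / Real.pi) ^ 2 / 8) =
        2 * (2 * n * y + Real.log (2 / δ)) := by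
      field_simp; ring
    have h4 := mul_le_mul_of_nonneg_right hm (by positivity : 0 ≤ (θ / Real.pi) ^ 2 / 8)
    rw [h3] at h4
    linarith
  calc _ ≤ 3 * (Real.exp (2 * n * y) * Real.exp (-(2 * (2 * n * y + Real.log (2 / δ))))) := by
        gcongr
    _ = 3 * (Real.exp (-(2 * n * y)) * (δ / 2) ^ 2) := by
        have h5 : δ / 2 = Real.exp (-Real.log (2 / δ)) := by
          rw [Real.exp_neg, Real.exp_log (by positivity), inv_div]
        rw [h5, ← Real.exp_nat_mul, ← Real.exp_add, ← Real.exp_add]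
        congr 2; push_cast; ring
    _ ≤ 3 * (1 * (δ / 2) ^ 2) := by
        gcongr
        exact Real.exp_le_one_iff.2 (by have := mul_nonneg hn0.le hy0; linarith)
    _ ≤ δ := by nlinarith

end SphericalWedge

open SphericalWedge in
theorem mainTheorem7 {Ω : Type*} [MeasurableSpace Ω] (P : Measure Ω) [IsProbabilityMeasure P]
    (n m : ℕ) (hn : 1 ≤ n) (hnm : n ≤ 2 * m)
    (θ : ℝ) (hθ : 0 < θ) (hθ_acute : θ < Real.pi / 2)
    (δ : ℝ) (hδ : 0 < δ)
    (a : Fin m → Ω → SphericalWedge.UnitSphere n)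
    (ha_law : ∀ i, HasLaw (a i) (SphericalWedge.uniform n) P)
    (ha_indep : iIndepFun a P)
    (hm : (m : ℝ) ≥ (4 * Real.pi / θ) ^ 2 *
      (2 * n * Real.log (2 * Real.exp 1 * m / n) + Real.log (2 / δ))) :
    ∃ E : Set Ω, MeasurableSet E ∧ P.real E ≥ 1 - δ ∧
      ∀ ω ∈ E, (⨆ W ∈ SphericalWedge.wedgesBelow n θ,
        SphericalWedge.empirical (fun i => a i ω) W) ≤ ENNReal.ofReal (2 * θ / Real.pi) := by
  -- For `δ ≥ 1` the empty event suffices.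
  rcases le_or_gt 1 δ with hδ1 | hδ1
  · exact ⟨∅, MeasurableSet.empty, by simpa using hδ1, by simp⟩
  have hpi := Real.pi_pos
  have hmpos : 0 < m := by omega
  have hm0 : (0 : ℝ) < m := by exact_mod_cast hmpos
  have hae : ∀ i, AEMeasurable (a i) P := fun i => (ha_law i).aemeasurable
  have : IsProbabilityMeasure (uniform n) := by
    -- As the law of a sample point, `uniform n` has total mass one.
    rw [← (ha_law ⟨0, hmpos⟩).map_eq]
    exact Measure.isProbabilityMeasure_map (hae _)
  let p : ℕ → EuclideanSpace ℝ (Fin n) × EuclideanSpace ℝ (Fin n) := TopologicalSpace.denseSeq _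
  let κ := {k : ℕ // (p k).1 ≠ 0 ∧ (p k).2 ≠ 0 ∧
    InnerProductGeometry.angle (p k).1 (p k).2 < θ}
  let V : κ → Set (UnitSphere n) := fun k =>
    symmDiff (hemisphere (p k).1) (hemisphere (p k).2)
  have hV : ∀ k, MeasurableSet (V k) := fun k =>
    (measurableSet_hemisphere _).symmDiff (measurableSet_hemisphere _)
  set ε : ℝ := θ / Real.pi with hε
  have hε0 : 0 < ε := by positivity
  have hVε : ∀ k, (uniform n).real (V k) ≤ ε := fun k =>
    (uniform_symmDiff_hemisphere_le k.2.1 k.2.2.1 (by linarith [k.2.2.2])).trans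
      (div_le_div_of_nonneg_right k.2.2.2.le hpi.le)
  let B : Set (Fin m → UnitSphere n) := {b | ∃ k, 2 * (ε * m) < hits (V k) b}
  have hB : MeasurableSet B := by
    simp only [B, Set.ofPred_exists]
    exact MeasurableSet.iUnion fun k => measurableSet_lt measurable_const (measurable_hits (hV k))
  have hPB : P {ω | (fun i => a i ω) ∈ B} ≤ ENNReal.ofReal δ := by
    have hmap := (iIndepFun_iff_map_fun_eq_pi_map hae).1 ha_indep
    simp_rw [(ha_law _).map_eq] at hmap
    change P ((fun ω i => a i ω) ⁻¹' B) ≤ _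
    rw [← Measure.map_apply_of_aemeasurable (aemeasurable_pi_lambda _ hae) hB, hmap]
    exact (measure_exists_hits_gt_le_exp (uniform n) hV hε0 hmpos hVε _
      (exists_traces_symmDiff_hemisphere _ _)).trans
      (ENNReal.ofReal_le_ofReal (failure_bound_le hn hnm hθ hδ hδ1.le hm))
  -- The `a i` are only almost everywhere measurable, so the bad event is replaced by a measurable
  -- hull of equal probability.
  refine ⟨(toMeasurable P {ω | (fun i => a i ω) ∈ B})ᶜ, (measurableSet_toMeasurable _ _).compl,
    ?_, fun ω hω => ?_⟩
  · rw [probReal_compl_eq_one_sub (measurableSet_toMeasurable _ _), measureReal_def,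
      measure_toMeasurable]
    have := ENNReal.toReal_le_of_le_ofReal hδ.le hPB
    linarith
  · have hωB : (fun i => a i ω) ∉ B := fun h => hω (subset_toMeasurable P _ h)
    refine iSup₂_le fun W hW => ?_
    obtain ⟨x, z, hx, hz, hangle, rfl⟩ := hW
    obtain ⟨_, ⟨k, rfl⟩, h1, h2, h3, h4⟩ := exists_mem_dense_wedge_inter_subset
      (fun i => a i ω) (TopologicalSpace.denseRange_denseSeq _) hx hz hangle
    have hle : hits (wedge x z) (fun i => a i ω) ≤ 2 * (ε * m) := by
      refine (hits_mono fun i hi => openWedge_subset_symmDiff _ _ (h4 i hi)).trans ?_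
      by_contra! h
      exact hωB ⟨⟨k, h1, h2, h3⟩, h⟩
    rw [empirical_apply, ← ENNReal.ofReal_natCast, ← ENNReal.ofReal_inv_of_pos hm0,
      ← ENNReal.ofReal_mul (by positivity)]
    refine ENNReal.ofReal_le_ofReal ?_
    rw [inv_mul_le_iff₀ hm0]
    refine hle.trans (le_of_eq ?_)
    rw [hε]; ring
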